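/- Let $K$ be an algebraic function field of one variable whose exact constant field is a finite field $\mathbb{F}_q$, let $\infty$ be a fixed place of $K$, let $A$ be the ring of all elements of $K$ that are integral outside $\infty$ (that is, lie in the valuation ring of every place of $K$ other than $\infty$), and let $G=GL_2(A)$, acting on $\mathbb{P}^1(K)$ by Möbius transformations. For $s\in\mathbb{P}^1(K)$ let $G(s)$ be the stabilizer of $s$ in $G$, and let $U(s)$ be the set of unipotent matrices in $G(s)$. Then: (1) For every $\sigma\in\mathrm{Aut}(G)$ and every $s\in\mathbb{P}^1(K)$ there is an $s'\in\mathbb{P}^1(K)$ with $\sigma(G(s))=G(s')$. (2) Whenever $\sigma\in\mathrm{Aut}(G)$ and $\sigma(G(s))=G(s')$, also $\sigma(U(s))=U(s')$. (3) For every $\sigma\in\mathrm{Aut}(G)$ and $s\in\mathbb{P}^1(K)$ the point $s'$ in (1) is unique, and the map $\widetilde{\sigma}\colon s\mapsto s'$ is a permutation of $\mathbb{P}^1(K)$. Moreover $\sigma\mapsto\widetilde{\sigma}$ is a group homomorphism from $\mathrm{Aut}(G)$ to the group of permutations of $\mathbb{P}^1(K)$; that is, $\mathrm{Aut}(G)$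 acts on $\mathbb{P}^1(K)$ by permutations. -/

import Mathlib

open scoped MatrixGroups LinearAlgebra.Projectivization

namespace DrinfeldModular

/-- A place of `K / k`, given by its valuation ring `k ⊆ O ⊊ K`. -/
structure Place (k K : Type*) [Field k] [Field K] [Algebra k K] where
  /-- The valuation ring of the place. -/
  ring : ValuationSubring K
  algebraMap_mem : ∀ c : k, algebraMap k K c ∈ ring
  ne_top : ring ≠ ⊤

/-- The ring `A` of all elements of `K` that are integral outside the place `pinf`, i.e. that lie
in the valuation ring of every other place. -/
def integralOutside {k K : Type*} [Field k] [Field K] [Algebra k K] (pinf : Place k K) :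
    Subalgebra k K where
  carrier := {x | ∀ P : Place k K, P ≠ pinf → x ∈ P.ring}
  mul_mem' hx hy P hP := P.ring.mul_mem _ _ (hx P hP) (hy P hP)
  add_mem' hx hy P hP := P.ring.add_mem _ _ (hx P hP) (hy P hP)
  algebraMap_mem' c P _ := P.algebraMap_mem c

/-- The Drinfeld modular group `G = GL₂(A)`. -/
abbrev ModularGroup {k K : Type*} [Field k] [Field K] [Algebra k K] (pinf : Place k K) : Type _ :=
  GL (Fin 2) (integralOutside pinf)

/-- The inclusion `GL₂(A) → GL₂(K)`. -/
def toGLK {k K : Type*} [Field k] [Field K] [Algebra k K] (pinf : Place k K) :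
    ModularGroup pinf →* GL (Fin 2) K :=
  Matrix.GeneralLinearGroup.map (algebraMap (integralOutside pinf) K)

/-- The stabilizer `G(s)` in `G` of the point `s` of `ℙ¹(K)`, on which `G` acts through
`GL₂(K)`, i.e. by Möbius transformations. -/
def cuspStabilizer {k K : Type*} [Field k] [Field K] [Algebra k K] (pinf : Place k K)
    (s : ℙ K (Fin 2 → K)) : Subgroup (ModularGroup pinf) :=
  (MulAction.stabilizer (GL (Fin 2) K) s).comap (toGLK pinf)

/-- The set `U(s)` of unipotent matrices in `G(s)`. -/
def cuspUnipotent {k K : Type*} [Field k] [Field K] [Algebra k K] (pinf : Place k K)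
    (s : ℙ K (Fin 2 → K)) : Set (ModularGroup pinf) :=
  {g | g ∈ cuspStabilizer pinf s ∧
    IsNilpotent ((g : Matrix (Fin 2) (Fin 2) (integralOutside pinf)) - 1)}

end DrinfeldModular

/-! Let p be the characteristic of K. By Frobenius, the nontrivial unipotents of G are the elements
u ≠ 1 with u ^ p = 1, a condition that automorphisms preserve. Such a u fixes exactly one point of
ℙ¹(K), and two of them commute iff they fix the same point. If u fixes s, then g * u * g⁻¹ fixes
only g • s, so g lies in G(s) iff g * u * g⁻¹ commutes with u. This describes G(s) by group theory
alone: σ carries G(s) to the stabilizer of the fixed point of σ u, and everything else is formal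
(`mem_stabilizer_iff_commute_conj`, `unipotent_commute_iff`).

Every point must be fixed by some such u. If K = Frac A, the point has coordinates v in A, and 1 +
`squareZeroMatrix v` works. The main labour is thus to show K = Frac A, which reduces to finding t
in A transcendental over k: K is then finite over k(t), and every z in K has a multiple q(t) z
integral over k[t], hence in A.

Such a t comes from a dimension count in the spirit of Riemann's inequality. Let x vanish at `pinf`
and n = [K : k(x)]. There are spaces of dimension (m + 1) n whose elements have poles only at zeros
of x, of order at most m + c measured in powers of x. Removing the poles other than `pinf` costs at
most n - 1 dimensions per order, not n, because `pinf` is exempt (`exists_relation_mod_of_pole`).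
What survives lies in A and has dimension growing with m, whereas the constants have dimension one.
-/

/-! ### Groups whose elements of order `p` have a unique fixed point -/

namespace MulAction

variable {Γ X : Type*} [Group Γ] [MulAction Γ X] {p : ℕ}

/-- If elements of order `p` have a unique fixed point and commute exactly when they share it, then
the stabilizer of a point is determined by any element of order `p` in it. -/
theorem mem_stabilizer_iff_commute_conj
    (hfix : ∀ u : Γ, u ^ p = 1 → u ≠ 1 → ∃ s : X, ∀ s', u • s' = s' ↔ s' = s)
    (hcomm : ∀ u v : Γ, u ^ p = 1 → u ≠ 1 → v ^ p = 1 → v ≠ 1 → ∀ s : X, u • s = s →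
      (Commute u v ↔ v • s = s))
    {u : Γ} (hu : u ^ p = 1) (hu1 : u ≠ 1) {s : X} (hus : u • s = s) (g : Γ) :
    g ∈ stabilizer Γ s ↔ Commute u (g * u * g⁻¹) := by
  have hc1 : (g * u * g⁻¹) ^ p = 1 := by rw [conj_pow, hu]; simp
  have hc2 : g * u * g⁻¹ ≠ 1 := by simpa [conj_eq_one_iff] using hu1
  rw [hcomm _ _ hu hu1 hc1 hc2 s hus, mem_stabilizer_iff]
  obtain ⟨s₀, h₀⟩ := hfix u hu hu1
  obtain rfl := (h₀ s).1 hus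
  -- The conjugate fixes s iff u fixes g⁻¹ • s, that is, iff g⁻¹ • s is the unique fixed point s.
  rw [mul_smul, mul_smul, ← eq_inv_smul_iff (g := g) (a := u • g⁻¹ • s), h₀, inv_smul_eq_iff,
    eq_comm]

/-- Under the same hypotheses, automorphisms map point stabilizers to point stabilizers. -/
theorem map_stabilizer_of_commute
    (hfix : ∀ u : Γ, u ^ p = 1 → u ≠ 1 → ∃ s : X, ∀ s', u • s' = s' ↔ s' = s)
    (hcomm : ∀ u v : Γ, u ^ p = 1 → u ≠ 1 → v ^ p = 1 → v ≠ 1 → ∀ s : X, u • s = s →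
      (Commute u v ↔ v • s = s))
    (hex : ∀ s : X, ∃ u : Γ, u ^ p = 1 ∧ u ≠ 1 ∧ u • s = s)
    (σ : MulAut Γ) (s : X) :
    ∃ s' : X, (stabilizer Γ s).map σ.toMonoidHom = stabilizer Γ s' := by
  obtain ⟨u, hu, hu1, hus⟩ := hex s
  have hσ : σ u ^ p = 1 := by rw [← map_pow, hu, map_one]
  have hσ1 : σ u ≠ 1 := by simpa using hu1
  obtain ⟨s', hs'⟩ := hfix _ hσ hσ1
  refine ⟨s', ?_⟩
  ext g
  rw [mem_stabilizer_iff_commute_conj hfix hcomm hσ hσ1 ((hs' s').2 rfl)]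
  obtain ⟨g, rfl⟩ := σ.surjective g
  have hconj : σ g * σ u * (σ g)⁻¹ = σ (g * u * g⁻¹) := by simp
  have hmem : σ g ∈ (stabilizer Γ s).map σ.toMonoidHom ↔ g ∈ stabilizer Γ s :=
    Subgroup.mem_map_iff_mem σ.injective
  rw [hconj, hmem, mem_stabilizer_iff_commute_conj hfix hcomm hu hu1 hus]
  exact ⟨fun h => h.map σ, fun h => σ.injective (by simpa using h.eq)⟩

/-- The stabilizer contains some u ≠ 1 with u ^ p = 1, whose only fixed point recovers s. -/
theorem stabilizer_injective_of_unique_fixedPoint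
    (hfix : ∀ u : Γ, u ^ p = 1 → u ≠ 1 → ∃ s : X, ∀ s', u • s' = s' ↔ s' = s)
    (hex : ∀ s : X, ∃ u : Γ, u ^ p = 1 ∧ u ≠ 1 ∧ u • s = s) :
    Function.Injective (fun s : X => stabilizer Γ s) := by
  intro s s' h
  obtain ⟨u, hu, hu1, hus⟩ := hex s
  obtain ⟨s₀, h₀⟩ := hfix u hu hu1
  have hus' : u ∈ stabilizer Γ s' := (show stabilizer Γ s = stabilizer Γ s' from h) ▸ hus
  exact ((h₀ s).1 hus).trans ((h₀ s').1 hus').symm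

/-- If automorphisms permute an injective family of subgroups, they act on the index set. -/
theorem exists_mulAut_perm {Γ X : Type*} [Group Γ] {H : X → Subgroup Γ}
    (hinj : Function.Injective H)
    (hmap : ∀ (σ : MulAut Γ) (s : X), ∃ s' : X, (H s).map σ.toMonoidHom = H s') :
    ∃ perm : MulAut Γ →* Equiv.Perm X, ∀ (σ : MulAut Γ) (s s' : X),
      (H s).map σ.toMonoidHom = H s' ↔ perm σ s = s' := by
  choose f hf using hmap
  have hf' (σ : MulAut Γ) (s s' : X) : (H s).map σ.toMonoidHom = H s' ↔ f σ s = s' := by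
    rw [hf, hinj.eq_iff]
  have hone (s : X) : f 1 s = s := (hf' 1 s s).1 (Subgroup.map_id _)
  have hmul (σ τ : MulAut Γ) (s : X) : f (σ * τ) s = f σ (f τ s) := by
    rw [← hf', ← hf, ← hf, Subgroup.map_map]
    rfl
  -- Bijectivity comes for free: a group action is by permutations.
  let act : MulAction (MulAut Γ) X := { smul := f, one_smul := hone, mul_smul := hmul }
  exact ⟨MulAction.toPermHom (MulAut Γ) X, hf'⟩

end MulAction

/-! ### Unipotent `2 × 2` matrices -/

section Unipotent

open Matrix

variable {K : Type*} [Field K]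

/-- The square-zero matrix with kernel and image spanned by `v`. -/
def squareZeroMatrix {R : Type*} [CommRing R] (v : Fin 2 → R) : Matrix (Fin 2) (Fin 2) R :=
  !![v 0 * v 1, -v 0 ^ 2; v 1 ^ 2, -(v 0 * v 1)]

theorem squareZeroMatrix_mul_self {R : Type*} [CommRing R] (v : Fin 2 → R) :
    squareZeroMatrix v * squareZeroMatrix v = 0 := by
  ext i j
  fin_cases i <;> fin_cases j <;> simp [squareZeroMatrix] <;> ring

theorem squareZeroMatrix_smul {R : Type*} [CommRing R] (c : R) (v : Fin 2 → R) :
    squareZeroMatrix (c • v) = c ^ 2 • squareZeroMatrix v := by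
  ext i j
  fin_cases i <;> fin_cases j <;> simp [squareZeroMatrix] <;> ring

/-- Trace and determinant vanish. A nonzero lower left entry c makes the first column span the
image, and t = c⁻¹; if c = 0, only the upper right entry survives. -/
theorem exists_eq_smul_squareZeroMatrix {N : Matrix (Fin 2) (Fin 2) K} (hN : IsNilpotent N) :
    ∃ v : Fin 2 → K, v ≠ 0 ∧ ∃ t : K, N = t • squareZeroMatrix v := by
  have htr : N.trace = 0 := (Matrix.isNilpotent_trace_of_isNilpotent hN).eq_zero
  have hdet : N.det = 0 := by
    obtain ⟨n, hn⟩ := hN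
    have : N.det ^ n = 0 := by rw [← Matrix.det_pow, hn, Matrix.det_zero]
    exact eq_zero_of_pow_eq_zero this
  rw [Matrix.trace_fin_two] at htr
  rw [Matrix.det_fin_two] at hdet
  have h11 : N 1 1 = -N 0 0 := by linear_combination htr
  have hsq : N 0 0 ^ 2 = -(N 0 1 * N 1 0) := by rw [h11] at hdet; linear_combination -hdet
  by_cases hc : N 1 0 = 0
  · have ha : N 0 0 = 0 := by simpa [hc] using hsq
    refine ⟨![1, 0], fun h => one_ne_zero (congrFun h 0), -N 0 1, ?_⟩
    ext i j
    fin_cases i <;> fin_cases j <;> simp [squareZeroMatrix, ha, hc, h11]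
  · refine ⟨![N 0 0, N 1 0], fun h => hc (congrFun h 1), (N 1 0)⁻¹, ?_⟩
    ext i j
    fin_cases i <;> fin_cases j <;> simp [squareZeroMatrix, h11] <;> field_simp
    linear_combination hsq

theorem Projectivization.mk_eq_mk_iff_fin_two {v w : Fin 2 → K} (hv : v ≠ 0) (hw : w ≠ 0) :
    Projectivization.mk K v hv = Projectivization.mk K w hw ↔ v 0 * w 1 = v 1 * w 0 := by
  rw [Projectivization.mk_eq_mk_iff']
  constructor
  · rintro ⟨a, rfl⟩
    simp; ring
  · intro h
    by_cases h0 : w 0 = 0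
    · have h1 : w 1 ≠ 0 := fun h1 => hw (by ext i; fin_cases i <;> assumption)
      refine ⟨v 1 / w 1, ?_⟩
      have hv0 : v 0 = 0 := by simpa [h0, h1] using h
      ext i; fin_cases i <;> simp [h0, hv0, h1]
    · refine ⟨v 0 / w 0, ?_⟩
      ext i; fin_cases i <;> simp [h0]
      field_simp; linear_combination h

/-- The determinant of the pair (g • w, w) is -t times the square of that of (w, v), so it vanishes
only when w is parallel to v. -/
theorem smul_mk_eq_iff_of_eq_one_add {g : GL (Fin 2) K} {v : Fin 2 → K} (hv : v ≠ 0) {t : K}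
    (ht : t ≠ 0) (hg : (g : Matrix (Fin 2) (Fin 2) K) = 1 + t • squareZeroMatrix v)
    (s : ℙ K (Fin 2 → K)) : g • s = s ↔ s = Projectivization.mk K v hv := by
  induction s with | h w hw =>
  rw [Projectivization.smul_mk, Projectivization.mk_eq_mk_iff_fin_two,
    Projectivization.mk_eq_mk_iff_fin_two]
  have hgw : g • w = w + t • (squareZeroMatrix v *ᵥ w) := by
    change (g : Matrix (Fin 2) (Fin 2) K) *ᵥ w = _
    rw [hg, add_mulVec, one_mulVec, smul_mulVec]
  have h : (g • w) 0 * w 1 - (g • w) 1 * w 0 = -t * (w 0 * v 1 - w 1 * v 0) ^ 2 := by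
    rw [hgw]
    simp [squareZeroMatrix, dotProduct, Fin.sum_univ_two]
    ring
  rw [← sub_eq_zero, h, ← sub_eq_zero (a := w 0 * v 1)]
  simp [ht]

/-- A nontrivial unipotent matrix has a unique fixed point on the projective line, which determines
it up to a scalar. -/
theorem exists_eq_one_add_smul_squareZeroMatrix {g : GL (Fin 2) K} (hg1 : g ≠ 1)
    (hg : IsNilpotent ((g : Matrix (Fin 2) (Fin 2) K) - 1)) :
    ∃ s : ℙ K (Fin 2 → K), (∃ t : K, (g : Matrix (Fin 2) (Fin 2) K) =
      1 + t • squareZeroMatrix s.rep) ∧ ∀ s', g • s' = s' ↔ s' = s := by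
  obtain ⟨v, hv, t, ht⟩ := exists_eq_smul_squareZeroMatrix hg
  have hgt : (g : Matrix (Fin 2) (Fin 2) K) = 1 + t • squareZeroMatrix v := by rw [← ht]; simp
  have ht0 : t ≠ 0 := by
    rintro rfl
    exact hg1 (Units.ext (by simpa using hgt))
  refine ⟨.mk K v hv, ?_, smul_mk_eq_iff_of_eq_one_add hv ht0 hgt⟩
  obtain ⟨a, ha⟩ := Projectivization.exists_smul_eq_mk_rep K v hv
  refine ⟨t * ((a⁻¹ : Kˣ) : K) ^ 2, ?_⟩
  rw [← ha, Units.smul_def, squareZeroMatrix_smul, smul_smul, hgt]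
  congr 2
  simp

/-- Commuting elements preserve each other's fixed points, and there is only one. Conversely, with a
common fixed point both are 1 plus a multiple of the same matrix. -/
theorem unipotent_commute_iff {g h : GL (Fin 2) K} (hg1 : g ≠ 1) (hh1 : h ≠ 1)
    (hg : IsNilpotent ((g : Matrix (Fin 2) (Fin 2) K) - 1))
    (hh : IsNilpotent ((h : Matrix (Fin 2) (Fin 2) K) - 1)) {s : ℙ K (Fin 2 → K)}
    (hs : g • s = s) : Commute g h ↔ h • s = s := by
  obtain ⟨s₁, ⟨t, ht⟩, h₁⟩ := exists_eq_one_add_smul_squareZeroMatrix hg1 hg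
  obtain ⟨s₂, ⟨t', ht'⟩, h₂⟩ := exists_eq_one_add_smul_squareZeroMatrix hh1 hh
  obtain rfl := (h₁ s).1 hs
  constructor
  · intro hc
    rw [← h₁, ← mul_smul, hc.eq, mul_smul, hs]
  · intro hhs
    obtain rfl := (h₂ s).1 hhs
    have : Commute (g : Matrix (Fin 2) (Fin 2) K) (h : Matrix (Fin 2) (Fin 2) K) := by
      rw [ht, ht']
      exact ((Commute.one_left _).add_left ((Commute.one_right _).add_right
        (((Commute.refl _).smul_left _).smul_right _)))
    exact Units.ext this

/-- Frobenius gives (g - 1) ^ p = g ^ p - 1, and a nilpotent 2 × 2 matrix has square zero, where 2 ≤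
p. -/
theorem isNilpotent_sub_one_iff_pow_eq_one {p : ℕ} [Fact p.Prime] [CharP K p]
    (g : GL (Fin 2) K) : IsNilpotent ((g : Matrix (Fin 2) (Fin 2) K) - 1) ↔ g ^ p = 1 := by
  have hp : ((g : Matrix (Fin 2) (Fin 2) K) - 1) ^ p = (g : Matrix (Fin 2) (Fin 2) K) ^ p - 1 := by
    rw [sub_pow_char_of_commute p (Commute.one_right _), one_pow]
  constructor
  · intro hg
    obtain ⟨v, hv, t, ht⟩ := exists_eq_smul_squareZeroMatrix hg
    have h0 : ((g : Matrix (Fin 2) (Fin 2) K) - 1) ^ p = 0 := by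
      refine pow_eq_zero_of_le (Fact.out : p.Prime).two_le ?_
      rw [ht, pow_two, smul_mul_smul_comm, squareZeroMatrix_mul_self, smul_zero]
    refine Units.ext ?_
    rw [hp, sub_eq_zero] at h0
    simpa using h0
  · intro hg
    refine ⟨p, ?_⟩
    rw [hp, ← Units.val_pow_eq_pow_val, hg, Units.val_one, sub_self]

end Unipotent

/-! ### Unipotents of GL₂(A) and the action on cusps, granted K = Frac A. -/

namespace DrinfeldModular

open Matrix

variable {k K : Type*} [Field k] [Field K] [Algebra k K]

theorem toGLK_injective (pinf : Place k K) : Function.Injective (toGLK pinf) := by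
  intro g h hgh
  ext i j
  have := congrArg (fun u : GL (Fin 2) K => (u : Matrix (Fin 2) (Fin 2) K) i j) hgh
  exact this

theorem isNilpotent_toGLK_sub_one_iff (pinf : Place k K) (g : ModularGroup pinf) :
    IsNilpotent ((toGLK pinf g : Matrix (Fin 2) (Fin 2) K) - 1) ↔
      IsNilpotent ((g : Matrix (Fin 2) (Fin 2) (integralOutside pinf)) - 1) := by
  have hinj : Function.Injective
      (RingHom.mapMatrix (m := Fin 2) (algebraMap (integralOutside pinf) K)) :=
    Matrix.map_injective Subtype.val_injective
  rw [← IsNilpotent.map_iff hinj, map_sub, map_one]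
  rfl

theorem isNilpotent_sub_one_iff_pow_eq_one (pinf : Place k K) {p : ℕ} [Fact p.Prime] [CharP K p]
    (g : ModularGroup pinf) :
    IsNilpotent ((g : Matrix (Fin 2) (Fin 2) (integralOutside pinf)) - 1) ↔ g ^ p = 1 := by
  rw [← isNilpotent_toGLK_sub_one_iff, _root_.isNilpotent_sub_one_iff_pow_eq_one (p := p),
    ← map_pow, map_eq_one_iff _ (toGLK_injective pinf)]

/-- If `K` is the fraction field of `A`, every point of the projective line is fixed by a
nontrivial unipotent matrix over `A`. -/
theorem exists_unipotent_mem_cuspStabilizer (pinf : Place k K)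
    (hfrac : ∀ x : K, ∃ d ∈ integralOutside pinf, d ≠ 0 ∧ d * x ∈ integralOutside pinf)
    (s : ℙ K (Fin 2 → K)) :
    ∃ u : ModularGroup pinf, u ≠ 1 ∧ u ∈ cuspUnipotent pinf s := by
  -- Clear denominators in homogeneous coordinates.
  obtain ⟨v, hv, rfl⟩ : ∃ (v : Fin 2 → integralOutside pinf)
      (hv : (fun i => (v i : K)) ≠ 0), s = Projectivization.mk K _ hv := by
    induction s with | h w hw =>
    obtain ⟨d, hd, hd0, hdw⟩ := hfrac (w 0)
    obtain ⟨e, he, he0, hew⟩ := hfrac (w 1)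
    have h0 : d * e * w 0 ∈ integralOutside pinf := by
      rw [mul_right_comm]; exact mul_mem hdw he
    have h1 : d * e * w 1 ∈ integralOutside pinf := by
      rw [mul_assoc]; exact mul_mem hd hew
    have hvw : (fun i => ((![⟨_, h0⟩, ⟨_, h1⟩] : Fin 2 → integralOutside pinf) i : K)) =
        (d * e) • w := by
      ext i; fin_cases i <;> rfl
    refine ⟨![⟨_, h0⟩, ⟨_, h1⟩], ?_, ?_⟩
    · rw [hvw]; exact smul_ne_zero (mul_ne_zero hd0 he0) hw
    · rw [Projectivization.mk_eq_mk_iff_fin_two]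
      simp; ring
  have hsq := squareZeroMatrix_mul_self v
  let u : ModularGroup pinf := ⟨1 + squareZeroMatrix v, 1 - squareZeroMatrix v,
    by noncomm_ring; simp [hsq], by noncomm_ring; simp [hsq]⟩
  have huK : (toGLK pinf u : Matrix (Fin 2) (Fin 2) K) =
      1 + (1 : K) • squareZeroMatrix (fun i => (v i : K)) := by
    have : (toGLK pinf u : Matrix (Fin 2) (Fin 2) K) =
      RingHom.mapMatrix (algebraMap (integralOutside pinf) K) (1 + squareZeroMatrix v) := rfl
    rw [this, map_add, map_one, one_smul]
    congr 1
    ext i j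
    fin_cases i <;> fin_cases j <;> simp [squareZeroMatrix]
  have hfix := smul_mk_eq_iff_of_eq_one_add hv one_ne_zero huK
  refine ⟨u, ?_, ?_, ?_⟩
  · intro hu
    have hz : squareZeroMatrix v = 0 := by
      have : (1 + squareZeroMatrix v : Matrix (Fin 2) (Fin 2) (integralOutside pinf)) = 1 :=
        congrArg Units.val hu
      simpa using this
    apply hv
    ext i
    fin_cases i
    · have := congrFun (congrFun hz 0) 1
      simpa [squareZeroMatrix] using this
    · have := congrFun (congrFun hz 1) 0
      simpa [squareZeroMatrix] using this
  · exact (hfix _).2 rfl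
  · refine ⟨2, ?_⟩
    change (1 + squareZeroMatrix v - 1) ^ 2 = 0
    rw [add_sub_cancel_left, pow_two, hsq]

/-- The action of automorphisms on the cusps, given that `K` is the fraction field of `A`. -/
theorem mulAut_acts_on_cusps {p : ℕ} [Fact p.Prime] [CharP K p] (pinf : Place k K)
    (hfrac : ∀ x : K, ∃ d ∈ integralOutside pinf, d ≠ 0 ∧ d * x ∈ integralOutside pinf) :
    (∀ (σ : MulAut (ModularGroup pinf)) (s : ℙ K (Fin 2 → K)), ∃ s' : ℙ K (Fin 2 → K),
        (cuspStabilizer pinf s).map σ.toMonoidHom = cuspStabilizer pinf s') ∧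
    (∀ (σ : MulAut (ModularGroup pinf)) (s s' : ℙ K (Fin 2 → K)),
      (cuspStabilizer pinf s).map σ.toMonoidHom = cuspStabilizer pinf s' →
        σ '' cuspUnipotent pinf s = cuspUnipotent pinf s') ∧
    (∃ perm : MulAut (ModularGroup pinf) →* Equiv.Perm (ℙ K (Fin 2 → K)),
      ∀ (σ : MulAut (ModularGroup pinf)) (s s' : ℙ K (Fin 2 → K)),
        (cuspStabilizer pinf s).map σ.toMonoidHom = cuspStabilizer pinf s' ↔
          perm σ s = s') := by
  -- For this action `stabilizer` unfolds to `cuspStabilizer`, so the abstract results apply as they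
  -- stand.
  let act : MulAction (ModularGroup pinf) (ℙ K (Fin 2 → K)) := MulAction.compHom _ (toGLK pinf)
  have hnil (u : ModularGroup pinf) (hu : u ^ p = 1) :
      IsNilpotent ((toGLK pinf u : Matrix (Fin 2) (Fin 2) K) - 1) := by
    rwa [isNilpotent_toGLK_sub_one_iff, isNilpotent_sub_one_iff_pow_eq_one (p := p)]
  have hne (u : ModularGroup pinf) (hu : u ≠ 1) : toGLK pinf u ≠ 1 := by
    rwa [Ne, map_eq_one_iff _ (toGLK_injective pinf)]
  have hfix (u : ModularGroup pinf) (hu : u ^ p = 1) (hu1 : u ≠ 1) :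
      ∃ s : ℙ K (Fin 2 → K), ∀ s', u • s' = s' ↔ s' = s := by
    obtain ⟨s, -, hs⟩ := exists_eq_one_add_smul_squareZeroMatrix (hne u hu1) (hnil u hu)
    exact ⟨s, hs⟩
  have hcomm (u v : ModularGroup pinf) (hu : u ^ p = 1) (hu1 : u ≠ 1) (hv : v ^ p = 1)
      (hv1 : v ≠ 1) (s : ℙ K (Fin 2 → K)) (hs : u • s = s) : Commute u v ↔ v • s = s := by
    refine Iff.trans ?_
      (unipotent_commute_iff (hne u hu1) (hne v hv1) (hnil u hu) (hnil v hv) hs)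
    exact ⟨fun h => h.map _, fun h => toGLK_injective pinf (by simpa using h.eq)⟩
  have hex (s : ℙ K (Fin 2 → K)) : ∃ u : ModularGroup pinf, u ^ p = 1 ∧ u ≠ 1 ∧ u • s = s := by
    obtain ⟨u, hu1, hus, hu⟩ := exists_unipotent_mem_cuspStabilizer pinf hfrac s
    exact ⟨u, (isNilpotent_sub_one_iff_pow_eq_one pinf u).1 hu, hu1, hus⟩
  have hmap := MulAction.map_stabilizer_of_commute hfix hcomm hex
  have hinj := MulAction.stabilizer_injective_of_unique_fixedPoint hfix hex
  refine ⟨hmap, ?_, MulAction.exists_mulAut_perm hinj hmap⟩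
  intro σ s s' h
  ext g
  obtain ⟨g, rfl⟩ := σ.surjective g
  rw [σ.injective.mem_set_image]
  change g ∈ cuspStabilizer pinf s ∧ _ ↔ σ g ∈ cuspStabilizer pinf s' ∧ _
  rw [← h, isNilpotent_sub_one_iff_pow_eq_one (p := p), isNilpotent_sub_one_iff_pow_eq_one (p := p),
    ← map_pow, map_eq_one_iff _ σ.injective]
  exact and_congr_left' (Subgroup.mem_map_iff_mem σ.injective).symm

end DrinfeldModular

/-! ### Places and transcendental elements -/

namespace DrinfeldModular

open Polynomial IntermediateField

variable {k K : Type*} [Field k] [Field K] [Algebra k K]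

namespace Place

theorem ext_ring {P Q : Place k K} (h : P.ring = Q.ring) : P = Q := by
  cases P; cases Q; simpa using h

theorem aeval_mem (P : Place k K) {x : K} (hx : x ∈ P.ring) (q : k[X]) :
    aeval x q ∈ P.ring := by
  rw [aeval_eq_sum_range]
  refine sum_mem fun i _ => ?_
  rw [Algebra.smul_def]
  exact mul_mem (P.algebraMap_mem _) (pow_mem hx i)

theorem valuation_algebraMap (P : Place k K) {c : k} (hc : c ≠ 0) :
    P.ring.valuation (algebraMap k K c) = 1 := by
  have h1 := (P.ring.valuation_le_one_iff _).2 (P.algebraMap_mem c)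
  have h2 := (P.ring.valuation_le_one_iff _).2 (P.algebraMap_mem c⁻¹)
  refine le_antisymm h1 ?_
  calc (1 : P.ring.ValueGroup) = P.ring.valuation (algebraMap k K c) *
        P.ring.valuation (algebraMap k K c⁻¹) := by rw [← map_mul, ← map_mul]; simp [hc]
    _ ≤ P.ring.valuation (algebraMap k K c) * 1 := by gcongr
    _ = _ := mul_one _

theorem mem_of_mem_nonunits (P : Place k K) {x : K} (hx : x ∈ P.ring.nonunits) : x ∈ P.ring :=
  (P.ring.valuation_le_one_iff x).1 (P.ring.mem_nonunits_iff.1 hx).le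

/-- Modulo the maximal ideal q(x) is its constant term, a nonzero constant and hence a unit. -/
theorem valuation_aeval (P : Place k K) {x : K} (hx : x ∈ P.ring.nonunits) {q : k[X]}
    (hq : q.coeff 0 ≠ 0) : P.ring.valuation (aeval x q) = 1 := by
  have h : aeval x q = aeval x q.divX * x + algebraMap k K (q.coeff 0) := by
    conv_lhs => rw [← divX_mul_X_add q]
    simp
  have hlt : P.ring.valuation (aeval x q.divX * x) < P.ring.valuation (algebraMap k K (q.coeff 0)) := by
    rw [P.valuation_algebraMap hq, map_mul]
    exact (mul_le_of_le_one_left'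
      ((P.ring.valuation_le_one_iff _).2 (P.aeval_mem (P.mem_of_mem_nonunits hx) _))).trans_lt
      (P.ring.mem_nonunits_iff.1 hx)
  rw [h, Valuation.map_add_eq_of_lt_right _ hlt, P.valuation_algebraMap hq]

theorem mem_of_isIntegral (P : Place k K) {x z : K} (hx : x ∈ P.ring)
    (hz : IsIntegral (Algebra.adjoin k {x}) z) : z ∈ P.ring := by
  have hle : ∀ a : Algebra.adjoin k {x}, (a : K) ∈ P.ring := by
    rintro ⟨a, ha⟩
    rw [Algebra.adjoin_singleton_eq_range_aeval] at ha
    obtain ⟨q, rfl⟩ := ha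
    exact P.aeval_mem hx q
  let φ : Algebra.adjoin k {x} →+* P.ring :=
    { toFun := fun a => ⟨a, hle a⟩
      map_one' := rfl
      map_mul' := fun _ _ => rfl
      map_zero' := rfl
      map_add' := fun _ _ => rfl }
  have : IsIntegral P.ring z := by
    obtain ⟨q, hq, hqz⟩ := hz
    refine ⟨q.map φ, hq.map φ, ?_⟩
    rw [eval₂_map]
    exact hqz
  obtain ⟨w, rfl⟩ := IsIntegrallyClosed.isIntegral_iff.1 this
  exact w.2

end Place

variable (k) in
/-- The elements regular at every place at which `x` is regular. -/
def regularRing (x : K) : Subalgebra k K where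
  carrier := {z | ∀ P : Place k K, x ∈ P.ring → z ∈ P.ring}
  mul_mem' hx hy P hP := P.ring.mul_mem _ _ (hx P hP) (hy P hP)
  add_mem' hx hy P hP := P.ring.add_mem _ _ (hx P hP) (hy P hP)
  algebraMap_mem' c P _ := P.algebraMap_mem c

/-- The elements regular at every zero of `x` other than `pinf`. -/
def regularAtZeros (pinf : Place k K) (x : K) : Subalgebra k K where
  carrier := {z | ∀ P : Place k K, P ≠ pinf → x ∈ P.ring.nonunits → z ∈ P.ring}
  mul_mem' hx hy P hP h := P.ring.mul_mem _ _ (hx P hP h) (hy P hP h)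
  add_mem' hx hy P hP h := P.ring.add_mem _ _ (hx P hP h) (hy P hP h)
  algebraMap_mem' c P _ _ := P.algebraMap_mem c

theorem self_mem_regularRing (x : K) : x ∈ regularRing k x := fun _ h => h

theorem aeval_ne_zero {x : K} (hx : Transcendental k x) {q : k[X]} (hq : q ≠ 0) :
    aeval x q ≠ 0 := fun h => hx ⟨q, hq, h⟩

/-- Some k[x]-multiple of z is integral over k[x], and valuation rings are integrally closed. -/
theorem exists_aeval_mul_mem_regularRing {x : K}
    [Algebra.IsAlgebraic k⟮x⟯ K] (z : K) :
    ∃ q : k[X], q ≠ 0 ∧ aeval x q * z ∈ regularRing k x := by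
  have hz : IsAlgebraic (Algebra.adjoin k {x}) z :=
    isAlgebraic_adjoin_iff.1 (Algebra.IsAlgebraic.isAlgebraic z)
  obtain ⟨⟨y, hy⟩, hy0, hyz⟩ := hz.exists_integral_multiple
  have hy' := hy
  rw [Algebra.adjoin_singleton_eq_range_aeval] at hy'
  obtain ⟨q, hq⟩ := hy'
  refine ⟨q, ?_, fun P hP => ?_⟩
  · rintro rfl
    exact hy0 (Subtype.ext (by simpa using hq.symm))
  · have := P.mem_of_isIntegral hP hyz
    rw [Algebra.smul_def] at this
    exact (show aeval x q = y from hq) ▸ this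

/-- Common powers of `X` can be removed from a nonzero family of polynomials. -/
theorem exists_eq_X_pow_mul {ι : Type*} {c : ι → k[X]} {i₀ : ι} (hc : c i₀ ≠ 0) :
    ∃ (N : ℕ) (d : ι → k[X]), (∀ i, c i = X ^ N * d i) ∧ ∃ i, (d i).coeff 0 ≠ 0 := by
  induction hn : (c i₀).natDegree using Nat.strong_induction_on generalizing c with
  | _ n ih =>
  by_cases h : ∃ i, (c i).coeff 0 ≠ 0
  · exact ⟨0, c, by simp, h⟩
  push Not at h
  have hdiv : ∀ i, c i = X * (c i).divX := fun i => by
    conv_lhs => rw [← divX_mul_X_add (c i), h i, C_0, add_zero, mul_comm]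
  have hne : (c i₀).divX ≠ 0 := fun h0 => hc (by rw [hdiv, h0, mul_zero])
  obtain ⟨N, d, hd, hi⟩ := ih (c i₀).divX.natDegree
    (by rw [← hn]; conv_rhs => rw [hdiv i₀, natDegree_X_mul hne]
        omega) (c := fun i => (c i).divX) hne rfl
  exact ⟨N + 1, d, fun i => by rw [hdiv, hd, pow_succ']; ring, hi⟩

/-- A linear dependence over `k(x)` yields one over `k[x]` that is nontrivial modulo `x`. -/
theorem exists_aeval_relation {x : K} (hx : Transcendental k x) {ι : Type*} [Fintype ι]
    {f : ι → K} (hf : ¬ LinearIndependent k⟮x⟯ f) :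
    ∃ c : ι → k[X], ∑ i, aeval x (c i) * f i = 0 ∧ ∃ i, (c i).coeff 0 ≠ 0 := by
  classical
  rw [Fintype.not_linearIndependent_iff] at hf
  obtain ⟨g, hg, i₀, hi₀⟩ := hf
  have hrs : ∀ i, ∃ r s : k[X], s ≠ 0 ∧ (g i : K) * aeval x s = aeval x r := by
    intro i
    obtain ⟨r, s, hrs⟩ := (mem_adjoin_simple_iff k _).1 (g i).2
    -- The representation r/s may have s = 0, where division returns 0; it is then replaced by 0/1.
    by_cases hs : s = 0
    · exact ⟨0, 1, one_ne_zero, by rw [hrs, hs]; simp⟩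
    · exact ⟨r, s, hs, by rw [hrs, div_mul_cancel₀ _ (aeval_ne_zero hx hs)]⟩
  choose r s hs hgr using hrs
  set c : ι → k[X] := fun i => r i * ∏ j ∈ Finset.univ.erase i, s j with hc
  have hcg : ∀ i, aeval x (c i) = aeval x (∏ j, s j) * (g i : K) := by
    intro i
    rw [← Finset.mul_prod_erase _ _ (Finset.mem_univ i), hc, map_mul, map_mul, ← hgr]
    ring
  have hprod : aeval x (∏ j, s j) ≠ 0 :=
    aeval_ne_zero hx (Finset.prod_ne_zero_iff.2 fun j _ => hs j)
  have hc0 : c i₀ ≠ 0 := by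
    intro h
    have := hcg i₀
    rw [h, map_zero, eq_comm, mul_eq_zero] at this
    exact hi₀ (Subtype.ext (this.resolve_left hprod))
  obtain ⟨N, d, hd, hi⟩ := exists_eq_X_pow_mul hc0
  refine ⟨d, ?_, hi⟩
  have hx0 : x ≠ 0 := by
    rintro rfl
    exact hx isAlgebraic_zero
  have hsum : x ^ N * ∑ i, aeval x (d i) * f i = 0 := by
    calc x ^ N * ∑ i, aeval x (d i) * f i = ∑ i, aeval x (c i) * f i := by
          rw [Finset.mul_sum]
          refine Finset.sum_congr rfl fun i _ => ?_
          rw [hd]; simp; ring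
      _ = aeval x (∏ j, s j) * ∑ i, g i • f i := by
          rw [Finset.mul_sum]
          refine Finset.sum_congr rfl fun i _ => ?_
          rw [hcg, IntermediateField.smul_def, smul_eq_mul]; ring
      _ = 0 := by rw [hg, mul_zero]
  exact (mul_eq_zero.1 hsum).resolve_left (pow_ne_zero _ hx0)

/-- The relation obtained by reducing a polynomial relation modulo `x`. -/
theorem sum_coeff_zero_smul {x : K} {ι : Type*} [Fintype ι] {f : ι → K} {c : ι → k[X]}
    {R : Subalgebra k K} (hxR : x ∈ R) (hf : ∀ i, f i ∈ R)
    (hc : ∑ i, aeval x (c i) * f i = 0) :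
    ∃ r ∈ R, ∑ i, (c i).coeff 0 • f i = x * r := by
  refine ⟨-∑ i, aeval x (c i).divX * f i, ?_, ?_⟩
  · refine neg_mem (sum_mem fun i _ => mul_mem ?_ (hf i))
    exact (aeval (⟨x, hxR⟩ : R) (c i).divX).2 |> fun h => by
      rwa [← Subalgebra.aeval_coe] at h
  · rw [mul_neg, eq_neg_iff_add_eq_zero, ← hc, Finset.mul_sum, ← Finset.sum_add_distrib]
    refine Finset.sum_congr rfl fun i _ => ?_
    conv_rhs => rw [← divX_mul_X_add (c i)]
    simp [Algebra.smul_def]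
    ring

/-- Elements dependent over `k(x)` are dependent over `k` modulo `x`. -/
theorem exists_relation_mod {x : K} (hx : Transcendental k x) {ι : Type*} [Fintype ι]
    {f : ι → K} {R : Subalgebra k K} (hxR : x ∈ R) (hfR : ∀ i, f i ∈ R)
    (hf : ¬ LinearIndependent k⟮x⟯ f) :
    ∃ a : ι → k, (∃ i, a i ≠ 0) ∧ ∃ r ∈ R, ∑ i, a i • f i = x * r := by
  obtain ⟨c, hc, hi⟩ := exists_aeval_relation hx hf
  exact ⟨fun i => (c i).coeff 0, hi, sum_coeff_zero_smul hxR hfR hc⟩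

/-- If `R` contains an element with a pole at the zero `P` of `x`, then `[K : k(x)]` elements of
`R` are linearly dependent modulo `x`. -/
theorem exists_relation_mod_of_pole {x : K} (hx : Transcendental k x) [FiniteDimensional k⟮x⟯ K]
    {P : Place k K} (hxP : x ∈ P.ring.nonunits) {ι : Type*} [Fintype ι]
    (hι : Fintype.card ι = Module.finrank k⟮x⟯ K) {f : ι → K} {R : Subalgebra k K}
    (hxR : x ∈ R) (hfR : ∀ i, f i ∈ R) {g : K} (hgR : g ∈ R) (hgP : g ∉ P.ring) :
    ∃ a : ι → k, (∃ i, a i ≠ 0) ∧ ∃ r ∈ R, ∑ i, a i • f i = x * r := by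
  classical
  have hpos : 0 < Fintype.card ι := hι ▸ Module.finrank_pos
  have : Nonempty ι := Fintype.card_pos_iff.1 hpos
  obtain ⟨i₀, hi₀⟩ := Finite.exists_max fun i => P.ring.valuation (f i)
  by_cases h0 : f i₀ = 0
  · exact ⟨Pi.single i₀ 1, ⟨i₀, by simp⟩, 0, zero_mem _, by
      simp [Pi.single_apply, ite_smul, h0]⟩
  -- At P the extra element `g * f i₀` has larger valuation than every `f i`. In a relation among
  -- these n + 1 elements its coefficient must therefore have zero constant term, so it drops out
  -- modulo x.
  let F : Option ι → K := fun o => o.elim (g * f i₀) f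
  have hF : ¬ LinearIndependent k⟮x⟯ F := by
    intro h
    have := h.fintype_card_le_finrank
    rw [Fintype.card_option, hι] at this
    omega
  obtain ⟨c, hc, hi⟩ := exists_aeval_relation hx hF
  by_cases hn : (c none).coeff 0 = 0
  · refine ⟨fun i => (c (some i)).coeff 0, ?_, ?_⟩
    · obtain ⟨_ | i, h⟩ := hi
      · exact absurd hn h
      · exact ⟨i, h⟩
    · obtain ⟨r, hr, h⟩ := sum_coeff_zero_smul (R := R) hxR
        (by rintro (_ | i); exacts [mul_mem hgR (hfR _), hfR i]) hc
      refine ⟨r, hr, ?_⟩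
      rw [← h, Fintype.sum_option, hn, zero_smul, zero_add]
      rfl
  · exfalso
    have hv : P.ring.valuation (aeval x (c none) * (g * f i₀)) ≤ P.ring.valuation (f i₀) := by
      rw [Fintype.sum_option, add_eq_zero_iff_eq_neg] at hc
      change aeval x (c none) * (g * f i₀) = -∑ i, aeval x (c (some i)) * f i at hc
      rw [hc, Valuation.map_neg]
      refine Valuation.map_sum_le _ fun i _ => ?_
      rw [map_mul]
      refine (mul_le_of_le_one_left' ?_).trans (hi₀ i)
      exact (P.ring.valuation_le_one_iff _).2 (P.aeval_mem (P.mem_of_mem_nonunits hxP) _)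
    rw [map_mul, map_mul, P.valuation_aeval hxP hn, one_mul] at hv
    have hg1 : 1 < P.ring.valuation g := by
      rw [← not_le, P.ring.valuation_le_one_iff]; exact hgP
    have hf0 : 0 < P.ring.valuation (f i₀) := by
      rw [zero_lt_iff]; exact (Valuation.ne_zero_iff _).2 h0
    exact absurd hv (not_le.2 (lt_mul_of_one_lt_left hf0 hg1))

end DrinfeldModular

/-! ### An element whose only pole among the zeros of `x` is a given place -/

namespace DrinfeldModular

open Polynomial IntermediateField

variable {k K : Type*} [Field k] [Field K] [Algebra k K]

/-- The upper parts of a polynomial relation for `z`, and their products with `z`, are integral. -/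
theorem sum_tail_mem (O : ValuationSubring K) {c : ℕ → K} (hc : ∀ i, c i ∈ O) {z : K} {j m : ℕ}
    (h : ∑ i ∈ Finset.range (j + m), c i * z ^ i = 0) :
    ∑ i ∈ Finset.range m, c (j + i) * z ^ i ∈ O ∧
      (∑ i ∈ Finset.range m, c (j + i) * z ^ i) * z ∈ O := by
  rcases O.mem_or_inv_mem z with hz | hz
  · have : ∑ i ∈ Finset.range m, c (j + i) * z ^ i ∈ O :=
      sum_mem fun i _ => mul_mem (hc _) (pow_mem hz _)
    exact ⟨this, mul_mem this hz⟩
  · rcases eq_or_ne z 0 with rfl | hz0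
    · have h0 : (0 : K) ∈ O := zero_mem _
      have : ∑ i ∈ Finset.range m, c (j + i) * (0 : K) ^ i ∈ O :=
        sum_mem fun i _ => mul_mem (hc _) (pow_mem h0 _)
      exact ⟨this, mul_mem this h0⟩
    set b := ∑ i ∈ Finset.range m, c (j + i) * z ^ i with hb
    have hsum : z ^ j * b = -∑ i ∈ Finset.range j, c i * z ^ i := by
      rw [Finset.sum_range_add, add_comm, add_eq_zero_iff_eq_neg] at h
      rw [← h, hb, Finset.mul_sum]
      exact Finset.sum_congr rfl fun i _ => by ring
    rcases j with _ | j
    · have : b = 0 := by simpa using hsum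
      rw [this, zero_mul]
      exact ⟨zero_mem _, zero_mem _⟩
    -- The relation trades the upper part for the lower one, making b * z a polynomial in z⁻¹.
    · have hbz : b * z = -∑ i ∈ Finset.range (j + 1), c i * z⁻¹ ^ (j - i) := by
        apply mul_left_cancel₀ (pow_ne_zero j hz0)
        calc z ^ j * (b * z) = z ^ (j + 1) * b := by ring
          _ = _ := by
            rw [hsum, mul_neg, Finset.mul_sum]
            congr 1
            refine Finset.sum_congr rfl fun i hi => ?_
            have hij : i ≤ j := Nat.lt_succ_iff.1 (Finset.mem_range.1 hi)
            obtain ⟨l, rfl⟩ := Nat.exists_eq_add_of_le hij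
            rw [Nat.add_sub_cancel_left, inv_pow, pow_add]
            field_simp
      have hmem : b * z ∈ O := by
        rw [hbz]
        exact neg_mem (sum_mem fun i _ => mul_mem (hc _) (pow_mem hz _))
      refine ⟨?_, hmem⟩
      have : b = b * z * z⁻¹ := by field_simp
      rw [this]
      exact mul_mem hmem hz

/-- At a zero of `x`, every element is a fraction over `regularRing k x` whose numerator and
denominator do not both vanish. -/
theorem exists_fraction_not_both_nonunits {x : K} (hx : Transcendental k x)
    [FiniteDimensional k⟮x⟯ K] {P : Place k K} (hxP : x ∈ P.ring.nonunits) (z : K) :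
    ∃ b ∈ regularRing k x, b * z ∈ regularRing k x ∧
      ¬ (b ∈ P.ring.nonunits ∧ b * z ∈ P.ring.nonunits) := by
  set n := Module.finrank k⟮x⟯ K
  have hdep : ¬ LinearIndependent k⟮x⟯ (fun i : Fin (n + 1) => z ^ (i : ℕ)) := by
    intro h
    have := h.fintype_card_le_finrank
    rw [Fintype.card_fin] at this
    omega
  obtain ⟨c, hc, i₀, hi₀⟩ := exists_aeval_relation hx hdep
  let C : ℕ → k[X] := fun i => if h : i < n + 1 then c ⟨i, h⟩ else 0
  have hCi (i : Fin (n + 1)) : C i = c i := dif_pos i.2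
  have hC : ∑ i ∈ Finset.range (n + 1), aeval x (C i) * z ^ i = 0 := by
    rw [← hc, ← Fin.sum_univ_eq_sum_range (fun i => aeval x (C i) * z ^ i)]
    exact Finset.sum_congr rfl fun i _ => by rw [hCi]
  have hmem (j m : ℕ) (hjm : j + m = n + 1) :
      ∑ i ∈ Finset.range m, aeval x (C (j + i)) * z ^ i ∈ regularRing k x ∧
      (∑ i ∈ Finset.range m, aeval x (C (j + i)) * z ^ i) * z ∈ regularRing k x :=
    ⟨fun Q hQ => (sum_tail_mem Q.ring (c := fun i => aeval x (C i))
        (fun i => Q.aeval_mem hQ _) (hjm ▸ hC)).1,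
      fun Q hQ => (sum_tail_mem Q.ring (c := fun i => aeval x (C i))
        (fun i => Q.aeval_mem hQ _) (hjm ▸ hC)).2⟩
  obtain ⟨m, hm⟩ := Nat.exists_eq_add_of_le (Nat.lt_succ_iff.1 i₀.2)
  have h0 := hmem i₀ (m + 1) (by omega)
  have h1 := hmem (i₀ + 1) m (by omega)
  -- Consecutive tails satisfy b₀ = b₁ * z + c(x), with c(x) a unit at P. Either b₁ * z is not in
  -- the maximal ideal and b₁ serves as denominator, or b₀ is a unit and serves itself.
  set b₁ := ∑ i ∈ Finset.range m, aeval x (C (i₀ + 1 + i)) * z ^ i with hb₁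
  have hb₀ : ∑ i ∈ Finset.range (m + 1), aeval x (C (i₀ + i)) * z ^ i =
      b₁ * z + aeval x (c i₀) := by
    rw [Finset.sum_range_succ', hb₁, Finset.sum_mul]
    congr 1
    · refine Finset.sum_congr rfl fun i _ => ?_
      rw [show (i₀ : ℕ) + (i + 1) = i₀ + 1 + i by omega]
      ring
    · simp [hCi]
  rw [hb₀] at h0
  by_cases hn : b₁ * z ∈ P.ring.nonunits
  · refine ⟨_, h0.1, h0.2, fun h => ?_⟩
    have hlt := h.1
    rw [P.ring.mem_nonunits_iff] at hlt hn
    rw [Valuation.map_add_eq_of_lt_right _ (by rwa [P.valuation_aeval hxP hi₀]),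
      P.valuation_aeval hxP hi₀] at hlt
    exact lt_irrefl _ hlt
  · exact ⟨_, h1.1, h1.2, fun h => hn h.2⟩

/-- A zero of `x` is determined by its center on `regularRing k x`. -/
theorem Place.le_of_center_le {x : K} (hx : Transcendental k x)
    [FiniteDimensional k⟮x⟯ K] {P Q : Place k K} (hP : x ∈ P.ring.nonunits)
    (hQ : x ∈ Q.ring.nonunits)
    (h : ∀ r ∈ regularRing k x, r ∈ Q.ring.nonunits → r ∈ P.ring.nonunits) :
    P.ring ≤ Q.ring := by
  intro z hz
  obtain ⟨b, hb, hbz, hnot⟩ := exists_fraction_not_both_nonunits hx hP z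
  have hbP : b ∉ P.ring.nonunits := by
    intro hbP
    refine hnot ⟨hbP, ?_⟩
    rw [P.ring.mem_nonunits_iff] at hbP ⊢
    rw [map_mul]
    exact (mul_le_of_le_one_right' ((P.ring.valuation_le_one_iff _).2 hz)).trans_lt hbP
  have hbQ : b ∉ Q.ring.nonunits := fun hbQ => hbP (h b hb hbQ)
  rw [Q.ring.mem_nonunits_iff_or, not_or, not_not] at hbQ
  have : z = b⁻¹ * (b * z) := by rw [inv_mul_cancel_left₀ hbQ.1]
  rw [this]
  exact mul_mem hbQ.2 (hbz Q (Q.mem_of_mem_nonunits hQ))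

/-- The center on `regularRing k x` of a place at which `x` is regular. -/
def Place.center (P : Place k K) {x : K} (hP : x ∈ P.ring.nonunits) : Ideal (regularRing k x) :=
  (IsLocalRing.maximalIdeal P.ring).comap
    ({ toFun := fun r => ⟨r, r.2 P (P.mem_of_mem_nonunits hP)⟩
       map_one' := rfl
       map_mul' := fun _ _ => rfl
       map_zero' := rfl
       map_add' := fun _ _ => rfl } : regularRing k x →+* P.ring)

instance Place.center_isPrime (P : Place k K) {x : K} (hP : x ∈ P.ring.nonunits) :
    (P.center hP).IsPrime := Ideal.comap_isPrime _ _

theorem Place.mem_center (P : Place k K) {x : K} (hP : x ∈ P.ring.nonunits)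
    (r : regularRing k x) : r ∈ P.center hP ↔ (r : K) ∈ P.ring.nonunits :=
  P.ring.coe_mem_nonunits_iff.symm

set_option synthInstance.maxHeartbeats 200000 in
/-- `regularRing k x` is finite over `k` modulo `x`. -/
theorem finite_regularRing_quotient {x : K} (hx : Transcendental k x)
    [FiniteDimensional k⟮x⟯ K] :
    Module.Finite k (regularRing k x ⧸
      Ideal.span {(⟨x, self_mem_regularRing x⟩ : regularRing k x)}) := by
  set I := Ideal.span {(⟨x, self_mem_regularRing x⟩ : regularRing k x)}
  refine Module.rank_lt_aleph0_iff.1 (lt_of_le_of_lt (rank_le (n := Module.finrank k⟮x⟯ K) ?_)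
    (Cardinal.natCast_lt_aleph0))
  intro s hs
  by_contra hcard
  -- More than [K : k(x)] lifts are dependent over k(x), hence over k modulo x.
  choose f hf using fun q : s => Ideal.Quotient.mk_surjective (I := I) q
  have hdep : ¬ LinearIndependent k⟮x⟯ (fun q : s => (f q : K)) := by
    intro h
    have := h.fintype_card_le_finrank
    rw [Fintype.card_coe] at this
    exact hcard this
  obtain ⟨a, ⟨i, hi⟩, r, hr, h⟩ :=
    exists_relation_mod hx (self_mem_regularRing x) (fun q => (f q).2) hdep
  refine hi (Fintype.linearIndependent_iff.1 hs a ?_ i)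
  have hfr : ∑ q, a q • f q = ⟨x, self_mem_regularRing x⟩ * (⟨r, hr⟩ : regularRing k x) := by
    apply Subtype.ext
    rw [AddSubmonoidClass.coe_finsetSum]
    exact h
  have : Ideal.Quotient.mkₐ k I (∑ q, a q • f q) = 0 := by
    rw [hfr, map_mul]
    have h0 : Ideal.Quotient.mkₐ k I ⟨x, self_mem_regularRing x⟩ = 0 :=
      Ideal.Quotient.eq_zero_iff_mem.2 (Ideal.mem_span_singleton_self _)
    rw [h0, zero_mul]
  rw [map_sum] at this
  rw [← this]
  refine Finset.sum_congr rfl fun q _ => ?_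
  rw [map_smul]
  congr 1
  exact (hf q).symm

-- Only finitely many primes of `regularRing k x` contain x, all of them maximal, and distinct zeros
-- of x have distinct centers. Prime avoidance gives h vanishing at `pinf` but at no other zero of
-- x; its inverse is the required element.
set_option synthInstance.maxHeartbeats 200000 in
theorem exists_mem_regularAtZeros_not_mem {x : K} (hx : Transcendental k x)
    [FiniteDimensional k⟮x⟯ K] {pinf : Place k K} (hxP : x ∈ pinf.ring.nonunits) :
    ∃ g ∈ regularAtZeros pinf x, g ∉ pinf.ring := by
  set X' : regularRing k x := ⟨x, self_mem_regularRing x⟩ with hX'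
  set I := Ideal.span {X'} with hI
  have hfin : Module.Finite k (regularRing k x ⧸ I) := finite_regularRing_quotient hx
  have hart : IsArtinianRing (regularRing k x ⧸ I) := IsArtinianRing.of_finite k _
  let T : Set (Ideal (regularRing k x)) := {q | q.IsPrime ∧ I ≤ q}
  have hmap (q : Ideal (regularRing k x)) (hq : q ∈ T) : (q.map (Ideal.Quotient.mk I)).IsPrime := by
    have := hq.1
    exact Ideal.map_isPrime_of_surjective Ideal.Quotient.mk_surjective
      (by rw [Ideal.mk_ker]; exact hq.2)
  have hT : T.Finite := by
    have : Finite {q : Ideal (regularRing k x ⧸ I) | q.IsPrime} :=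
      IsArtinianRing.setOfPred_isPrime_finite _
    refine Set.Finite.of_finite_image (f := fun q => q.map (Ideal.Quotient.mk I))
      ((Set.toFinite {q : Ideal (regularRing k x ⧸ I) | q.IsPrime}).subset ?_) ?_
    · rintro _ ⟨q, hq, rfl⟩
      exact hmap q hq
    · intro q hq q' hq' h
      rw [← Ideal.comap_map_mk hq.2, ← Ideal.comap_map_mk hq'.2]
      exact congrArg _ h
  have hmax (q : Ideal (regularRing k x)) (hq : q ∈ T) : q.IsMaximal := by
    have := hmap q hq
    have : (q.map (Ideal.Quotient.mk I)).IsMaximal := IsArtinianRing.isMaximal_of_isPrime _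
    rw [← Ideal.comap_map_mk hq.2]
    exact Ideal.comap_isMaximal_of_surjective _ Ideal.Quotient.mk_surjective
  have hcenter (P : Place k K) (hP : x ∈ P.ring.nonunits) : P.center hP ∈ T := by
    refine ⟨inferInstance, ?_⟩
    rw [hI, Ideal.span_singleton_le_iff_mem, P.mem_center hP]
    exact hP
  obtain ⟨h, hmem, hnot⟩ : ∃ h ∈ pinf.center hxP, ∀ q ∈ T \ {pinf.center hxP}, h ∉ q := by
    by_contra! hcon
    -- The two ⊥ fill the slots for ideals exempt from primality; every ideal here is prime.
    obtain ⟨q, hq, hle⟩ := (Ideal.subset_union_prime_finite (hT.sdiff (t := {pinf.center hxP}))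
      (f := id) ⊥ ⊥ (fun q hq _ _ => hq.1.1)).1 (fun r hr => by
        obtain ⟨q, hq, hrq⟩ := hcon r hr
        exact Set.mem_biUnion hq hrq)
    exact hq.2 ((hmax _ (hcenter pinf hxP)).eq_of_le hq.1.1.ne_top hle).symm
  obtain ⟨h, hmem, hnot, h0⟩ :
      ∃ h ∈ pinf.center hxP, (∀ q ∈ T \ {pinf.center hxP}, h ∉ q) ∧ (h : K) ≠ 0 := by
    -- If h = 0 there are no other primes to avoid, and x serves instead.
    by_cases h0 : (h : K) = 0
    · refine ⟨X', (pinf.mem_center hxP _).2 hxP, fun q hq => ?_, ?_⟩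
      · refine absurd ?_ (hnot q hq)
        rw [show h = 0 from Subtype.ext h0]
        exact zero_mem _
      · rintro (rfl : x = 0)
        exact hx isAlgebraic_zero
    · exact ⟨h, hmem, hnot, h0⟩
  rw [pinf.mem_center] at hmem
  refine ⟨(h : K)⁻¹, ?_, ?_⟩
  · intro P hP hPx
    have hne : P.center hPx ≠ pinf.center hxP := by
      intro heq
      apply hP
      have hiff (r : K) (hr : r ∈ regularRing k x) :
          r ∈ P.ring.nonunits ↔ r ∈ pinf.ring.nonunits := by
        rw [← P.mem_center hPx ⟨r, hr⟩, heq, pinf.mem_center]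
      exact Place.ext_ring (le_antisymm
        (Place.le_of_center_le hx hPx hxP fun r hr => (hiff r hr).2)
        (Place.le_of_center_le hx hxP hPx fun r hr => (hiff r hr).1))
    have := hnot _ ⟨hcenter P hPx, hne⟩
    rw [P.mem_center, P.ring.mem_nonunits_iff_or, not_or, not_not] at this
    exact this.2
  · exact (pinf.ring.mem_nonunits_iff_or.1 hmem).resolve_left h0

end DrinfeldModular

/-! ### Nonconstant elements of `A` -/

namespace DrinfeldModular

open Polynomial IntermediateField

variable {k K : Type*} [Field k] [Field K] [Algebra k K]

/-- The elements `z` with `x ^ j * z` regular at every zero of `x` other than `pinf`. -/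
def poleBounded (pinf : Place k K) (x : K) (j : ℕ) : Submodule k K :=
  (Subalgebra.toSubmodule (regularAtZeros pinf x)).comap (LinearMap.mulLeft k (x ^ j))

theorem mem_poleBounded {pinf : Place k K} {x : K} {j : ℕ} {z : K} :
    z ∈ poleBounded pinf x j ↔ x ^ j * z ∈ regularAtZeros pinf x := Iff.rfl

theorem self_mem_regularAtZeros (pinf : Place k K) (x : K) : x ∈ regularAtZeros pinf x :=
  fun P _ h => P.mem_of_mem_nonunits h

theorem poleBounded_mono (pinf : Place k K) (x : K) : Monotone (poleBounded pinf x) := by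
  refine monotone_nat_of_le_succ fun j z hz => ?_
  rw [mem_poleBounded] at hz ⊢
  rw [pow_succ', mul_assoc]
  exact mul_mem (self_mem_regularAtZeros pinf x) hz

/-- Lowering the permitted pole order by one costs less than `[K : k(x)]` dimensions. -/
theorem finrank_le_finrank_inf_add {x : K} (hx : Transcendental k x)
    [FiniteDimensional k⟮x⟯ K] {pinf : Place k K} (hxP : x ∈ pinf.ring.nonunits) {j : ℕ}
    {W : Submodule k K} [FiniteDimensional k W] (hW : W ≤ poleBounded pinf x (j + 1)) :
    Module.finrank k W ≤ Module.finrank k (W ⊓ poleBounded pinf x j : Submodule k K) +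
      (Module.finrank k⟮x⟯ K - 1) := by
  set M := poleBounded pinf x j
  let φ : W →ₗ[k] K ⧸ M := M.mkQ ∘ₗ W.subtype
  have hker : Module.finrank k (LinearMap.ker φ) = Module.finrank k (W ⊓ M : Submodule k K) := by
    have : LinearMap.ker φ = M.comap W.subtype := by
      rw [LinearMap.ker_comp, Submodule.ker_mkQ]
    rw [this, ← Submodule.map_comap_subtype]
    exact (LinearEquiv.finrank_eq (Submodule.equivSubtypeMap W _))
  rw [← φ.finrank_range_add_finrank_ker, hker, add_comm]
  gcongr
  by_contra! hlt
  set n := Module.finrank k⟮x⟯ K with hn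
  have hle : n ≤ Module.finrank k (LinearMap.range φ) := by omega
  obtain ⟨e, he⟩ : ∃ e : Fin n → LinearMap.range φ, LinearIndependent k e :=
    ⟨_, (Module.finBasis k (LinearMap.range φ)).linearIndependent.comp (Fin.castLE hle)
      (Fin.castLE_injective hle)⟩
  choose w hw using fun i => (e i).2
  obtain ⟨g, hg, hgP⟩ := exists_mem_regularAtZeros_not_mem hx hxP
  -- Multiplication by x ^ (j + 1) moves W into `regularAtZeros`. A relation modulo x there says
  -- that a combination of the w i has pole order at most j, so it dies in the quotient.
  obtain ⟨a, ⟨i, hi⟩, r, hr, h⟩ := exists_relation_mod_of_pole hx hxP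
    (f := fun i => x ^ (j + 1) * (w i : K)) (by rw [Fintype.card_fin])
    (self_mem_regularAtZeros pinf x) (fun i => mem_poleBounded.1 (hW (w i).2)) hg hgP
  refine hi (Fintype.linearIndependent_iff.1 he a ?_ i)
  have hx0 : x ≠ 0 := by
    rintro rfl
    exact hx isAlgebraic_zero
  have hmem : ((∑ i, a i • w i : W) : K) ∈ M := by
    rw [mem_poleBounded]
    convert hr using 1
    apply mul_left_cancel₀ hx0
    rw [← h, AddSubmonoidClass.coe_finsetSum, Finset.mul_sum, Finset.mul_sum]
    refine Finset.sum_congr rfl fun i _ => ?_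
    simp [Algebra.smul_def]
    ring
  apply Subtype.ext
  rw [AddSubmonoidClass.coe_finsetSum]
  calc ∑ i, ((a i • e i : LinearMap.range φ) : K ⧸ M) = φ (∑ i, a i • w i) := by
        rw [map_sum]
        refine Finset.sum_congr rfl fun i _ => ?_
        rw [map_smul, hw]; rfl
    _ = 0 := (Submodule.Quotient.mk_eq_zero _).2 hmem

theorem finrank_le_finrank_inf_poleBounded_zero_add {x : K} (hx : Transcendental k x)
    [FiniteDimensional k⟮x⟯ K] {pinf : Place k K} (hxP : x ∈ pinf.ring.nonunits) (N : ℕ)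
    {W : Submodule k K} [FiniteDimensional k W] (hW : W ≤ poleBounded pinf x N) :
    Module.finrank k W ≤ Module.finrank k (W ⊓ poleBounded pinf x 0 : Submodule k K) +
      N * (Module.finrank k⟮x⟯ K - 1) := by
  induction N generalizing W with
  | zero => rw [inf_eq_left.2 hW]; omega
  | succ N ih =>
    have h1 := finrank_le_finrank_inf_add hx hxP hW
    have : FiniteDimensional k (W ⊓ poleBounded pinf x N : Submodule k K) :=
      Submodule.finiteDimensional_of_le inf_le_left
    have h2 := ih (W := W ⊓ poleBounded pinf x N) inf_le_right
    rw [inf_assoc, inf_eq_right.2 (poleBounded_mono pinf x (Nat.zero_le N))] at h2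
    calc _ ≤ _ := h1
      _ ≤ _ := Nat.add_le_add_right h2 _
      _ = _ := by ring

/-- Every element has bounded pole order at the zeros of `x`. -/
theorem exists_mem_poleBounded {x : K} [FiniteDimensional k⟮x⟯ K]
    (pinf : Place k K) (z : K) : ∃ N, z ∈ poleBounded pinf x N := by
  obtain ⟨q, hq, hqz⟩ := exists_aeval_mul_mem_regularRing (k := k) (x := x) z
  -- The cofactor d has nonzero constant term, so d(x) is a unit at every zero of x and only x ^ N
  -- matters.
  obtain ⟨N, d, hd, _, hd0⟩ := exists_eq_X_pow_mul (c := fun _ : Unit => q) (i₀ := ()) hq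
  refine ⟨N, fun P _ hP => ?_⟩
  have h := hqz P (P.mem_of_mem_nonunits hP)
  rw [hd (), map_mul, map_pow, aeval_X, mul_right_comm] at h
  rw [← P.ring.valuation_le_one_iff, map_mul, P.valuation_aeval hP hd0, mul_one] at h
  exact (P.ring.valuation_le_one_iff _).1 h

theorem _root_.Transcendental.linearIndependent_pow {R S : Type*} [CommRing R] [Ring S]
    [Algebra R S] {y : S} (hy : Transcendental R y) : LinearIndependent R (fun j : ℕ => y ^ j) := by
  have hinj : LinearMap.ker (aeval (R := R) y).toLinearMap = ⊥ := by
    rw [LinearMap.ker_eq_bot']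
    intro r hr
    by_contra hr0
    exact hy ⟨r, hr0, hr⟩
  have h := (basisMonomials R).linearIndependent.map' _ hinj
  have hfun : (aeval (R := R) y).toLinearMap ∘ basisMonomials R = fun j : ℕ => y ^ j := by
    ext j
    simp
  rwa [hfun] at h

/-- There are large spaces of elements regular away from the zeros of `x`, with controlled poles
there. -/
theorem exists_large_submodule {x : K} (hx : Transcendental k x) [FiniteDimensional k⟮x⟯ K]
    [FiniteDimensional k⟮x⁻¹⟯ K] (pinf : Place k K) :
    ∃ c : ℕ, ∀ m : ℕ, ∃ W : Submodule k K, FiniteDimensional k W ∧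
      Module.finrank k W = (m + 1) * Module.finrank k⟮x⟯ K ∧ W ≤ poleBounded pinf x (m + c) ∧
      ∀ z ∈ W, z ∈ regularRing k x⁻¹ := by
  have hx0 : x ≠ 0 := by
    rintro rfl
    exact hx isAlgebraic_zero
  have hy : Transcendental k x⁻¹ := by rwa [Transcendental, IsAlgebraic.inv_iff]
  have hyF : x⁻¹ ∈ k⟮x⟯ := inv_mem (mem_adjoin_simple_self k x)
  let y : k⟮x⟯ := ⟨x⁻¹, hyF⟩
  have hcoe (q : k[X]) : ((aeval y q : k⟮x⟯) : K) = aeval x⁻¹ q :=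
    (IntermediateField.aeval_coe k⟮x⟯ y q).symm
  set n := Module.finrank k⟮x⟯ K
  let b := Module.finBasis k⟮x⟯ K
  choose q hq hqb using fun i => exists_aeval_mul_mem_regularRing (k := k) (x := x⁻¹) (b i)
  have hne (i) : aeval y (q i) ≠ 0 := by
    intro h
    apply aeval_ne_zero hy (hq i)
    rw [← hcoe, h]; rfl
  let e : Fin n → K := fun i => aeval y (q i) • b i
  have he : LinearIndependent k⟮x⟯ e :=
    b.linearIndependent.units_smul (fun i => Units.mk0 _ (hne i))
  have hereg (i) : e i ∈ regularRing k x⁻¹ := by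
    have : e i = aeval x⁻¹ (q i) * b i := by
      rw [← hcoe]; rfl
    rw [this]; exact hqb i
  choose N hN using fun i => exists_mem_poleBounded (x := x) pinf (e i)
  -- The sum bounds the pole orders of all e i at once; a factor y ^ j with j ≤ m adds at most m.
  refine ⟨∑ i, N i, fun m => ?_⟩
  have hpow : LinearIndependent k (fun j : Fin (m + 1) => y ^ (j : ℕ)) := by
    have hyt : Transcendental k y := fun ⟨r, hr0, hr⟩ =>
      aeval_ne_zero hy hr0 (by rw [← hcoe, hr]; rfl)
    exact hyt.linearIndependent_pow.comp _ Fin.val_injective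
  have hli := linearIndependent_smul hpow he
  refine ⟨Submodule.span k (Set.range fun p : Fin (m + 1) × Fin n => y ^ (p.1 : ℕ) • e p.2),
    FiniteDimensional.span_of_finite k (Set.finite_range _), ?_, ?_, ?_⟩
  · rw [finrank_span_eq_card hli]
    simp
  · rw [Submodule.span_le]
    rintro _ ⟨⟨j, i⟩, rfl⟩
    have hi : e i ∈ poleBounded pinf x (∑ i, N i) :=
      poleBounded_mono pinf x (Finset.single_le_sum (fun _ _ => Nat.zero_le _)
        (Finset.mem_univ i)) (hN i)
    obtain ⟨l, hl⟩ := Nat.exists_eq_add_of_le (Nat.lt_succ_iff.1 j.2)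
    rw [SetLike.mem_coe, mem_poleBounded]
    have : x ^ (m + ∑ i, N i) * (y ^ (j : ℕ) • e i) = x ^ l * (x ^ (∑ i, N i) * e i) := by
      have : y ^ (j : ℕ) • e i = x⁻¹ ^ (j : ℕ) * e i := rfl
      have hpw : x ^ m = x ^ (j : ℕ) * x ^ l := by rw [← pow_add, ← hl]
      rw [this, inv_pow, pow_add, hpw]
      field_simp
    change x ^ (m + ∑ i, N i) * (y ^ (j : ℕ) • e i) ∈ _
    rw [this]
    exact mul_mem (pow_mem (self_mem_regularAtZeros pinf x) _) hi
  · intro z hz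
    refine (Submodule.span_le (p := Subalgebra.toSubmodule (regularRing k x⁻¹))).2 ?_ hz
    rintro _ ⟨⟨j, i⟩, rfl⟩
    exact (regularRing k x⁻¹).mul_mem (pow_mem (self_mem_regularRing x⁻¹) _) (hereg i)

/-- An element regular at the zeros of `x` and at the zeros of `x⁻¹`, except possibly at `pinf`,
lies in `A`. -/
theorem mem_integralOutside_of_regular {pinf : Place k K} {x z : K}
    (h1 : z ∈ regularAtZeros pinf x)
    (h2 : z ∈ regularRing k x⁻¹) : z ∈ integralOutside pinf := by
  intro P hP
  by_cases h : x⁻¹ ∈ P.ring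
  · exact h2 P h
  · refine h1 P hP ?_
    rw [← inv_inv x, P.ring.inv_mem_nonunits_iff]
    exact .inr h

/-- `A` contains an element that is transcendental over the constant field. -/
theorem exists_transcendental_mem_integralOutside [Algebra (RatFunc k) K]
    [IsScalarTower k (RatFunc k) K] [FunctionField k K] (hk : algebraicClosure k K = ⊥)
    (pinf : Place k K) : ∃ t ∈ integralOutside pinf, Transcendental k t := by
  by_contra! hcon
  have hconst : ∀ z ∈ integralOutside pinf, z ∈ Submodule.span k {(1 : K)} := by
    intro z hz
    have : z ∈ algebraicClosure k K := by
      rw [mem_algebraicClosure_iff]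
      exact not_not.1 (hcon z hz)
    rw [hk, IntermediateField.mem_bot] at this
    obtain ⟨c, rfl⟩ := this
    rw [Algebra.algebraMap_eq_smul_one]
    exact Submodule.smul_mem _ _ (Submodule.mem_span_singleton_self _)
  obtain ⟨y, hy⟩ : ∃ y, y ∉ pinf.ring := by
    by_contra! h
    exact pinf.ne_top (ValuationSubring.ext _ _ fun z => ⟨fun _ => trivial, fun _ => h z⟩)
  have hyt : Transcendental k y := by
    intro hya
    have : y ∈ algebraicClosure k K := by
      rw [mem_algebraicClosure_iff]; exact hya
    rw [hk, IntermediateField.mem_bot] at this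
    obtain ⟨c, rfl⟩ := this
    exact hy (pinf.algebraMap_mem c)
  -- An element with a pole at `pinf` is inverted to obtain x vanishing there.
  obtain ⟨x, rfl⟩ : ∃ x, y = x⁻¹ := ⟨y⁻¹, (inv_inv y).symm⟩
  have hx : Transcendental k x := by rwa [Transcendental, IsAlgebraic.inv_iff] at hyt
  have hx0 : x ≠ 0 := by
    rintro rfl
    exact hx isAlgebraic_zero
  have hxP : x ∈ pinf.ring.nonunits := pinf.ring.mem_nonunits_iff_or.2 (.inr hy)
  have := FunctionField.finiteDimensional_of_adjoin_transcendental hx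
  have := FunctionField.finiteDimensional_of_adjoin_transcendental hyt
  obtain ⟨c, hc⟩ := exists_large_submodule hx pinf
  set n := Module.finrank k⟮x⟯ K with hn
  have hn0 : 0 < n := Module.finrank_pos
  -- With m = c n + 2 the count (m + 1) n - (m + c)(n - 1) equals n + c + 2, which exceeds 1.
  obtain ⟨W, hWfin, hWrank, hWpole, hWreg⟩ := hc (c * n + 2)
  have hle := finrank_le_finrank_inf_poleBounded_zero_add hx hxP _ hWpole
  have hsub : W ⊓ poleBounded pinf x 0 ≤ Submodule.span k {(1 : K)} := by
    rintro z ⟨hz1, hz2⟩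
    refine hconst z (mem_integralOutside_of_regular ?_ (hWreg z hz1))
    simpa using mem_poleBounded.1 hz2
  have h1 : Module.finrank k (W ⊓ poleBounded pinf x 0 : Submodule k K) ≤ 1 :=
    (Submodule.finrank_mono hsub).trans (finrank_span_singleton one_ne_zero).le
  rw [hWrank] at hle
  obtain ⟨l, hl⟩ := Nat.exists_eq_add_of_lt hn0
  rw [← hn, hl] at hle
  simp only [zero_add, Nat.add_sub_cancel] at hle
  nlinarith

/-- `K` is the fraction field of `A`. -/
theorem exists_mul_mem_integralOutside [Algebra (RatFunc k) K]
    [IsScalarTower k (RatFunc k) K] [FunctionField k K] (hk : algebraicClosure k K = ⊥)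
    (pinf : Place k K) (z : K) :
    ∃ d ∈ integralOutside pinf, d ≠ 0 ∧ d * z ∈ integralOutside pinf := by
  obtain ⟨t, ht, htr⟩ := exists_transcendental_mem_integralOutside hk pinf
  have := FunctionField.finiteDimensional_of_adjoin_transcendental htr
  obtain ⟨q, hq, hqz⟩ := exists_aeval_mul_mem_regularRing (k := k) (x := t) z
  exact ⟨aeval t q, fun P hP => P.aeval_mem (ht P hP) q, aeval_ne_zero htr hq,
    fun P hP => hqz P (ht P hP)⟩

end DrinfeldModular

/-! ### The theorem, with p the characteristic of the constant field. -/

theorem mainTheorem2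
    {k K : Type*} [Field k] [Finite k] [Field K] [Algebra k K]
    [Algebra (RatFunc k) K] [IsScalarTower k (RatFunc k) K] [FunctionField k K]
    (hk : algebraicClosure k K = ⊥)
    (pinf : DrinfeldModular.Place k K) :
    (∀ (σ : MulAut (DrinfeldModular.ModularGroup pinf)) (s : ℙ K (Fin 2 → K)),
      ∃ s' : ℙ K (Fin 2 → K),
        (DrinfeldModular.cuspStabilizer pinf s).map σ.toMonoidHom =
          DrinfeldModular.cuspStabilizer pinf s') ∧
    (∀ (σ : MulAut (DrinfeldModular.ModularGroup pinf)) (s s' : ℙ K (Fin 2 → K)),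
      (DrinfeldModular.cuspStabilizer pinf s).map σ.toMonoidHom =
          DrinfeldModular.cuspStabilizer pinf s' →
        σ '' DrinfeldModular.cuspUnipotent pinf s = DrinfeldModular.cuspUnipotent pinf s') ∧
    (∃ perm : MulAut (DrinfeldModular.ModularGroup pinf) →* Equiv.Perm (ℙ K (Fin 2 → K)),
      ∀ (σ : MulAut (DrinfeldModular.ModularGroup pinf)) (s s' : ℙ K (Fin 2 → K)),
        (DrinfeldModular.cuspStabilizer pinf s).map σ.toMonoidHom =
          DrinfeldModular.cuspStabilizer pinf s' ↔ perm σ s = s') := by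
  obtain ⟨p, hp⟩ := CharP.exists k
  have : Fact p.Prime := ⟨(CharP.char_is_prime_or_zero k p).resolve_right
    (CharP.char_ne_zero_of_finite k p)⟩
  have : CharP K p := charP_of_injective_algebraMap (algebraMap k K).injective p
  exact DrinfeldModular.mulAut_acts_on_cusps (p := p) pinf
    (DrinfeldModular.exists_mul_mem_integralOutside hk pinf)
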